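/- **Setting.** Let $\mathcal X$ be a measurable space and let $\mathcal Y=\mathcal Y_1\times\dots\times\mathcal Y_l$ be a product of finite sets. Let $F$ be the finite set of factor nodes of a factor graph with variable nodes $\{1,\dots,l\}$. For $f\in F$ let $\mathcal N(f)\subseteq\{1,\dots,l\}$ be the set of neighbours of $f$, let $\mathcal Y_f=\prod_{k\in\mathcal N(f)}\mathcal Y_k$, and let $y_f=(y^k)_{k\in\mathcal N(f)}$ for $y\in\mathcal Y$. Assume $|\mathcal Y_f|=d$ for all $f\in F$. Let $\Psi_f:\mathcal X\times\mathcal Y_f\to\mathbb R^D$ be measurable feature maps, and put $\Psi(x,y)=\sum_{f\in F}\Psi_f(x,y_f)$ and $h^w(x,y)=\langle w,\Psi(x,y)\rangle$ for $w\in\mathbb R^D$. Let $1<p\le 2$, $q=p/(p-1)$, $\Lambda\ge 0$, $\rho>0$, and assume that $$\Psi^*=\sup_{f\in F,\;x\in\mathcal X,\;y\in\mathcal Y_f}\|\Psi_f(x,y)\|_q<\infty .$$ Let $L:\mathcal Y\times\mathcal Y\to[0,\infty)$ be a loss function, $M=\max_{y,y'}L(y,y')$ and $\Phi^*(r)=\min(M,\max(0,r))$.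 The margin loss of $h:\mathcal X\times\mathcal Y\to\mathbb R$ is $$L_\rho(x,y,h)=\Phi^*\Big(\max_{y'\ne y}\Big\{L(y',y)-\tfrac1\rho\big[h(x,y)-h(x,y')\big]\Big\}\Big)$$ (read as $0$ if $\mathcal Y=\{y\}$), and the loss class is $F_{p,\Lambda,\rho}=\{(x,y)\mapsto L_\rho(x,y,h^w):\ w\in\mathbb R^D,\ \|w\|_p\le\Lambda\}$. For a class $G$ of real functions on $\mathcal X\times\mathcal Y$ and a sample $S=(z_1,\dots,z_m)\in(\mathcal X\times\mathcal Y)^m$ let $\mathfrak R_S(G)=\mathbb E_\sigma\big[\sup_{g\in G}\frac1m\sum_{i=1}^m\sigma_i g(z_i)\big]$, where $\sigma$ is uniformly distributed on $\{-1,1\}^m$. For a probability distribution $\mathcal D$ on $\mathcal X\times\mathcal Y$ let $\mathfrak R(G)=\mathbb E_{S\sim\mathcal D^m}[\mathfrak R_S(G)]$. **Theorem.** For every $m\ge 2$ and every sample $S\in(\mathcal X\times\mathcal Y)^m$, $$\mathfrak R_S(F_{p,\Lambda,\rho})\le\frac4m+\frac{144\sqrt{q-1}\,\Psi^*\Lambda|F|}{\rho\sqrt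 m}\,\tilde L,\qquad \tilde L=\sqrt{\log\!\Big(2md|F|\Big[\frac{8\Psi^*\Lambda m|F|}{\rho}+3\Big]+1\Big)}\;\log m .$$ Moreover, for every probability distribution $\mathcal D$ on $\mathcal X\times\mathcal Y$ the map $S\mapsto\mathfrak R_S(F_{p,\Lambda,\rho})$ is $\mathcal D^m$-integrable, and $\mathfrak R(F_{p,\Lambda,\rho})$ satisfies the same bound. -/

import Mathlib

open MeasureTheory

namespace StructuredPrediction

noncomputable section

/-- The label set `𝒴_f = ∏_{k ∈ 𝒩(f)} 𝒴_k` of a factor `f`. The edge set of the factor graph with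
variable nodes `Fin l` and factor nodes `F` is given by the neighbourhoods `N f ⊆ Fin l`. -/
abbrev FactorLabel {l : ℕ} {F : Type*} (N : F → Finset (Fin l)) (Y : Fin l → Type*) (f : F) :
    Type _ :=
  (k : {k : Fin l // k ∈ N f}) → Y k

/-- The part `y_f = (y^k)_{k ∈ 𝒩(f)}` of a label `y` that the factor `f` sees. -/
def restrictLabel {l : ℕ} {F : Type*} (N : F → Finset (Fin l)) {Y : Fin l → Type*}
    (y : (k : Fin l) → Y k) (f : F) : FactorLabel N Y f :=
  fun k => y k

/-- The `ℓ_p` norm `(∑ i, |w_i| ^ p) ^ (1 / p)` of a vector of `ℝ^D`. -/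
def lpNormVec {D : ℕ} (p : ℝ) (w : Fin D → ℝ) : ℝ :=
  (∑ i, |w i| ^ p) ^ (1 / p)

/-- The joint feature map `Ψ(x, y) = ∑_{f ∈ F} Ψ_f(x, y_f)`. -/
def jointFeature {X F : Type*} [Fintype F] {l D : ℕ} (N : F → Finset (Fin l))
    {Y : Fin l → Type*} (Ψ : (f : F) → X → FactorLabel N Y f → (Fin D → ℝ))
    (x : X) (y : (k : Fin l) → Y k) : Fin D → ℝ :=
  ∑ f, Ψ f x (restrictLabel N y f)

/-- The linear scoring function `h^w(x, y) = ⟨w, Ψ(x, y)⟩`. -/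
def score {X F : Type*} [Fintype F] {l D : ℕ} (N : F → Finset (Fin l))
    {Y : Fin l → Type*} (Ψ : (f : F) → X → FactorLabel N Y f → (Fin D → ℝ))
    (w : Fin D → ℝ) (x : X) (y : (k : Fin l) → Y k) : ℝ :=
  ∑ i, w i * jointFeature N Ψ x y i

/-- The hypothesis class `ℋ_p` of all `h^w` with `‖w‖_p ≤ Λ`. -/
def linearClass {X F : Type*} [Fintype F] {l D : ℕ} (N : F → Finset (Fin l))
    {Y : Fin l → Type*} (Ψ : (f : F) → X → FactorLabel N Y f → (Fin D → ℝ))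
    (p Λ : ℝ) : Set (X → ((k : Fin l) → Y k) → ℝ) :=
  {h | ∃ w : Fin D → ℝ, lpNormVec p w ≤ Λ ∧ h = score N Ψ w}

/-- `M = max_{y, y'} L(y, y')` (used for a finite label set). -/
def maxLoss {𝒴 : Type*} (L : 𝒴 → 𝒴 → ℝ) : ℝ :=
  ⨆ z : 𝒴 × 𝒴, L z.1 z.2

/-- The clipping function `Φ^*(r) = min(M, max(0, r))`. -/
def clip (M r : ℝ) : ℝ :=
  min M (max 0 r)

/-- The margin loss
`L_ρ(x, y, h) = Φ^*(max_{y' ≠ y} {L(y', y) - (h(x, y) - h(x, y')) / ρ})`, for a finite label set.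
If `y` is the only label, the supremum over the empty family is `0`, so that `L_ρ(x, y, h) = 0`, as
with the convention `max ∅ = -∞`. -/
def marginLoss {X 𝒴 : Type*} (L : 𝒴 → 𝒴 → ℝ) (ρ : ℝ) (h : X → 𝒴 → ℝ) (x : X) (y : 𝒴) : ℝ :=
  clip (maxLoss L) (⨆ y' : {y' : 𝒴 // y' ≠ y}, (L y' y - 1 / ρ * (h x y - h x y')))

/-- The loss class `F_{p,Λ,ρ} = {(x, y) ↦ L_ρ(x, y, h) : h ∈ ℋ_p}`. -/
def lossClass {X F : Type*} [Fintype F] {l D : ℕ} (N : F → Finset (Fin l))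
    {Y : Fin l → Type*} (Ψ : (f : F) → X → FactorLabel N Y f → (Fin D → ℝ))
    (L : ((k : Fin l) → Y k) → ((k : Fin l) → Y k) → ℝ) (p Λ ρ : ℝ) :
    Set (X × ((k : Fin l) → Y k) → ℝ) :=
  (fun h z => marginLoss L ρ h z.1 z.2) '' linearClass N Ψ p Λ

/-- The empirical Rademacher complexity
`𝔼_σ [sup_{g ∈ G} (1/m) ∑ i, σ_i g(z_i)]` of `G` on the sample `S = (z_1, …, z_m)`; the expectation
is the average over all `2 ^ m` sign vectors `σ ∈ {-1, 1}^m`. -/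
def empiricalRademacher {Z : Type*} {m : ℕ} (G : Set (Z → ℝ)) (S : Fin m → Z) : ℝ :=
  (1 / 2 ^ m) * ∑ σ : Fin m → ℤˣ,
    sSup ((fun g : Z → ℝ => (1 / (m : ℝ)) * ∑ i, (((σ i : ℤˣ) : ℤ) : ℝ) * g (S i)) '' G)

/-- The Rademacher complexity: the expectation of the empirical Rademacher complexity over an
i.i.d. sample of size `m` from the distribution `μ`. -/
def rademacherComplexity {Z : Type*} [MeasurableSpace Z] (μ : Measure Z) (m : ℕ)
    (G : Set (Z → ℝ)) : ℝ :=
  ∫ S : Fin m → Z, empiricalRademacher G S ∂(Measure.pi fun _ => μ)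

/-- The set of all norms `‖Ψ_f(x, y)‖_q` with `f ∈ F`, `x ∈ 𝒳`, `y ∈ 𝒴_f`. -/
def featureNorms {X F : Type*} {l D : ℕ} (N : F → Finset (Fin l))
    {Y : Fin l → Type*} (Ψ : (f : F) → X → FactorLabel N Y f → (Fin D → ℝ)) (q : ℝ) : Set ℝ :=
  {r | ∃ (f : F) (x : X) (y : FactorLabel N Y f), r = lpNormVec q (Ψ f x y)}

/-- `Ψ^* = sup_{f, x, y} ‖Ψ_f(x, y)‖_q`. -/
def featureSup {X F : Type*} {l D : ℕ} (N : F → Finset (Fin l))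
    {Y : Fin l → Type*} (Ψ : (f : F) → X → FactorLabel N Y f → (Fin D → ℝ)) (q : ℝ) : ℝ :=
  sSup (featureNorms N Ψ q)

/-- `L̃ = √(log(2 m d |F| [8 Ψ^* Λ m |F| / ρ + 3] + 1)) · log m`, where `n` is `|F|` and `s` is
`Ψ^*`. -/
def logFactor (m d n : ℕ) (s Λ ρ : ℝ) : ℝ :=
  √(Real.log (2 * m * d * n * (8 * s * Λ * m * n / ρ + 3) + 1)) * Real.log m

/-- `4 / m + 144 √(q - 1) Ψ^* Λ |F| / (ρ √m) · L̃`, where `n` is `|F|` and `s` is `Ψ^*`. -/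
def complexityBound (m d n : ℕ) (q s Λ ρ : ℝ) : ℝ :=
  4 / m + 144 * √(q - 1) * s * Λ * n / (ρ * √(m : ℝ)) * logFactor m d n s Λ ρ

end

end StructuredPrediction

open StructuredPrediction

/-! On a sample, the loss of `h^w` depends on `w` only through the `m * d * |F|` numbers `⟨w,
Ψ_f(x_i, y_f)⟩`, and it is Lipschitz in them for the sup norm with constant `2 * |F| / ρ`. It
therefore suffices to cover the `ℓ_p` ball of weights in the sup norm over these points and to apply
Dudley chaining.

The cover comes from convex duality. For `q ≥ 2` the squared `ℓ_q` norm is smooth with constant of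
order `q - 1` (`exists_smooth_descent`). Given a target `w`, a greedy descent on `‖θ‖_q ^ 2 - 2⟨w,
θ⟩` moves along `±` one badly approximated point at a time. The potential is bounded below, so after
about `12 (q - 1) (ab / ε) ^ 2` moves the dual vector of `θ` approximates `w` within `ε` on all
points. Encoding `w` by its moves gives a cover whose log-cardinality is that number times `log(2 *
#points + 1)`, independently of the dimension (`exists_sup_norm_cover`).

At scale `2^-k` the log-cardinality grows like `4^k`, so by Massart's lemma every level of the chain
contributes equally; about `log₂ m` levels produce the factor `log m`. This already gives the second
summand of the bound, with room to spare in the logarithm; the term `4 / m` is only added at the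
end. -/

/-! ### Two-point inequality for `q`-th powers. -/

theorem one_add_rpow_add_one_sub_rpow_le {q t : ℝ} (hq : 2 ≤ q) (ht0 : 0 ≤ t) (ht1 : t ≤ 1) :
    (1 + t) ^ q + (1 - t) ^ q ≤ 2 * (1 + 6 * (q - 1) * t ^ 2) ^ (q / 2) := by
  have hq0 : 0 ≤ q / 2 := by linarith
  have h6 : 3 * (q * t ^ 2) ≤ 6 * (q - 1) * t ^ 2 := by nlinarith [sq_nonneg t]
  -- If `q t² ≤ 1`, then `1 ± t ≤ exp(±t)` bounds the left side by `2 cosh(qt) ≤ 2 exp(q²t²/2)`, and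
  -- `exp s ≤ 1 + 2s` at `s = q t²` finishes. Otherwise `(1 + t)² ≤ 1 + 3 ≤ 1 + 3 q t²`.
  rcases le_or_gt (q * t ^ 2) 1 with h | h
  · have h1 : (1 + t) ^ q ≤ Real.exp (q * t) := by
      rw [mul_comm, Real.exp_mul]
      exact Real.rpow_le_rpow (by linarith) (by linarith [Real.add_one_le_exp t]) (by linarith)
    have h2 : (1 - t) ^ q ≤ Real.exp (-(q * t)) := by
      rw [show -(q * t) = -t * q by ring, Real.exp_mul]
      exact Real.rpow_le_rpow (by linarith) (by linarith [Real.add_one_le_exp (-t)]) (by linarith)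
    have h3 := Real.cosh_le_exp_half_sq (q * t)
    rw [Real.cosh_eq] at h3
    have hs0 : 0 ≤ q * t ^ 2 := by positivity
    have h4 : Real.exp (q * t ^ 2) ≤ 1 + 6 * (q - 1) * t ^ 2 := by
      have := Real.abs_exp_sub_one_sub_id_le (x := q * t ^ 2) (by rw [abs_of_nonneg hs0]; exact h)
      have := (abs_le.mp this).2
      nlinarith
    have h5 : Real.exp ((q * t) ^ 2 / 2) ≤ (1 + 6 * (q - 1) * t ^ 2) ^ (q / 2) := by
      rw [show (q * t) ^ 2 / 2 = q * t ^ 2 * (q / 2) by ring, Real.exp_mul]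
      exact Real.rpow_le_rpow (Real.exp_pos _).le h4 hq0
    linarith
  · have h1 : (1 - t) ^ q ≤ (1 + t) ^ q :=
      Real.rpow_le_rpow (by linarith) (by linarith) (by linarith)
    have h2 : (1 + t) ^ q ≤ (1 + 6 * (q - 1) * t ^ 2) ^ (q / 2) := by
      rw [show q = 2 * (q / 2) by ring, Real.rpow_mul (by linarith),
        show 2 * (q / 2) = q by ring]
      refine Real.rpow_le_rpow (by positivity) ?_ hq0
      rw [Real.rpow_two]
      nlinarith
    linarith

theorem add_rpow_add_sub_rpow_le {q a b : ℝ} (hq : 2 ≤ q) (hb : 0 ≤ b) (hab : b ≤ a) :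
    (a + b) ^ q + (a - b) ^ q ≤ 2 * (a ^ 2 + 6 * (q - 1) * b ^ 2) ^ (q / 2) := by
  rcases (hb.trans hab).eq_or_lt with h | ha
  · subst h
    obtain rfl : b = 0 := le_antisymm hab hb
    have : q ≠ 0 := by linarith
    simp [this]
  · have h := one_add_rpow_add_one_sub_rpow_le hq (div_nonneg hb ha.le) ((div_le_one ha).2 hab)
    have e1 : a + b = a * (1 + b / a) := by field_simp
    have e2 : a - b = a * (1 - b / a) := by field_simp
    have e3 : a ^ 2 + 6 * (q - 1) * b ^ 2 = a ^ (2 : ℝ) * (1 + 6 * (q - 1) * (b / a) ^ 2) := by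
      rw [Real.rpow_two]; field_simp
    have h1 : 0 ≤ 1 - b / a := by rw [sub_nonneg]; exact (div_le_one ha).2 hab
    have h2 : 0 ≤ 1 + 6 * (q - 1) * (b / a) ^ 2 := by
      have : 0 ≤ q - 1 := by linarith
      positivity
    rw [e1, e2, e3, Real.mul_rpow ha.le (by positivity), Real.mul_rpow ha.le h1,
      Real.mul_rpow (by positivity) h2, ← Real.rpow_mul ha.le, show 2 * (q / 2) = q by ring]
    have : 0 ≤ a ^ q := by positivity
    nlinarith

theorem abs_add_rpow_add_abs_sub_rpow_le {q : ℝ} (hq : 2 ≤ q) (a b : ℝ) :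
    |a + b| ^ q + |a - b| ^ q ≤ 2 * (a ^ 2 + 6 * (q - 1) * b ^ 2) ^ (q / 2) := by
  have key : ∀ u v : ℝ, |v| ≤ |u| →
      |u + v| ^ q + |u - v| ^ q ≤ 2 * (u ^ 2 + 6 * (q - 1) * v ^ 2) ^ (q / 2) := by
    intro u v h
    have h1 := add_rpow_add_sub_rpow_le hq (abs_nonneg v) h
    rw [sq_abs, sq_abs] at h1
    refine le_trans (le_of_eq ?_) h1
    rcases abs_cases u with ⟨hu, hu'⟩ | ⟨hu, hu'⟩ <;> rcases abs_cases v with ⟨hv, hv'⟩ | ⟨hv, hv'⟩ <;>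
      rw [hu, hv] at h ⊢
    · rw [abs_of_nonneg (by linarith), abs_of_nonneg (by linarith)]
    · rw [abs_of_nonneg (by linarith), abs_of_nonneg (by linarith), add_comm]; ring_nf
    · rw [abs_of_nonpos (by linarith), abs_of_nonpos (by linarith), add_comm]; ring_nf
    · rw [abs_of_nonpos (by linarith), abs_of_nonpos (by linarith)]; ring_nf
  rcases le_total |b| |a| with h | h
  · exact key a b h
  -- Swapping the roles is harmless: since `6 (q - 1) ≥ 1`, the larger coefficient on the right may
  -- be moved to the larger square.
  · have h1 := key b a h
    rw [add_comm b a, abs_sub_comm b a] at h1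
    refine h1.trans ?_
    have h2 := sq_le_sq.2 h
    gcongr 2 * ?_
    refine Real.rpow_le_rpow ?_ ?_ (by linarith)
    · have : 0 ≤ q - 1 := by linarith
      positivity
    · nlinarith

/-! ### Smoothness of the squared `ℓ_q` norm. -/

section LpNorm

variable {D : ℕ}

theorem lpNormVec_nonneg (p : ℝ) (w : Fin D → ℝ) : 0 ≤ lpNormVec p w := by
  unfold lpNormVec; positivity

theorem lpNormVec_rpow {p : ℝ} (hp : p ≠ 0) (w : Fin D → ℝ) :
    lpNormVec p w ^ p = ∑ i, |w i| ^ p := by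
  unfold lpNormVec
  rw [← Real.rpow_mul (by positivity), one_div_mul_cancel hp, Real.rpow_one]

theorem lpNormVec_smul {p : ℝ} (hp : 0 < p) (c : ℝ) (w : Fin D → ℝ) :
    lpNormVec p (c • w) = |c| * lpNormVec p w := by
  unfold lpNormVec
  simp only [Pi.smul_apply, smul_eq_mul, abs_mul]
  rw [Finset.sum_congr rfl fun i _ => Real.mul_rpow (abs_nonneg c) (abs_nonneg (w i)),
    ← Finset.mul_sum, Real.mul_rpow (by positivity) (by positivity),
    ← Real.rpow_mul (abs_nonneg c), mul_one_div_cancel hp.ne', Real.rpow_one]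

theorem lpNormVec_zero {p : ℝ} (hp : 0 < p) : lpNormVec p (0 : Fin D → ℝ) = 0 := by
  have := lpNormVec_smul hp 0 (0 : Fin D → ℝ)
  simpa using this

theorem lpNormVec_sq {q : ℝ} (hq : 0 < q) (w : Fin D → ℝ) :
    lpNormVec q w ^ 2 = (∑ i, (w i ^ 2) ^ (q / 2)) ^ (1 / (q / 2)) := by
  unfold lpNormVec
  rw [← Real.rpow_two, ← Real.rpow_mul (by positivity), show 1 / q * 2 = 1 / (q / 2) by field_simp]
  congr 1
  refine Finset.sum_congr rfl fun i _ => ?_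
  rw [← sq_abs, ← Real.rpow_two, ← Real.rpow_mul (abs_nonneg _), show 2 * (q / 2) = q by ring]

theorem sum_mul_le_lpNormVec {p q : ℝ} (hpq : p.HolderConjugate q) (w x : Fin D → ℝ) :
    ∑ i, w i * x i ≤ lpNormVec p w * lpNormVec q x :=
  Real.inner_le_Lp_mul_Lq _ _ _ hpq

theorem abs_sum_mul_le_lpNormVec {p q : ℝ} (hpq : p.HolderConjugate q) (w x : Fin D → ℝ) :
    |∑ i, w i * x i| ≤ lpNormVec p w * lpNormVec q x := by
  refine abs_le'.2 ⟨sum_mul_le_lpNormVec hpq w x, ?_⟩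
  have h := sum_mul_le_lpNormVec hpq w ((-1 : ℝ) • x)
  rw [lpNormVec_smul hpq.symm.pos] at h
  simpa using h

/-- Convexity of `u ↦ u ^ (q/2)` reduces the claim to the coordinatewise two-point inequality;
Minkowski in `ℓ_{q/2}`, applied to the squared coordinates, then separates `x` from `y`. -/
theorem lpNormVec_add_sq_add_sub_sq_le {q : ℝ} (hq : 2 ≤ q) (x y : Fin D → ℝ) :
    lpNormVec q (x + y) ^ 2 + lpNormVec q (x - y) ^ 2
      ≤ 2 * (lpNormVec q x ^ 2 + 6 * (q - 1) * lpNormVec q y ^ 2) := by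
  have hq0 : 0 < q := by linarith
  have hs : 1 ≤ q / 2 := by linarith
  have hs0 : 0 < q / 2 := by linarith
  have hκ : 0 ≤ 6 * (q - 1) := by linarith
  set u := lpNormVec q (x + y) ^ 2 with hu
  set v := lpNormVec q (x - y) ^ 2 with hv
  have hu0 : 0 ≤ u := by positivity
  have hv0 : 0 ≤ v := by positivity
  have pow_eq : ∀ z : Fin D → ℝ, (lpNormVec q z ^ 2) ^ (q / 2) = ∑ i, |z i| ^ q := by
    intro z
    rw [← lpNormVec_rpow hq0.ne', ← Real.rpow_two, ← Real.rpow_mul (lpNormVec_nonneg _ _),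
      show 2 * (q / 2) = q by ring]
  have h1 : ((u + v) / 2) ^ (q / 2) ≤ ∑ i, (x i ^ 2 + (√(6 * (q - 1)) * y i) ^ 2) ^ (q / 2) := by
    have h2 := (convexOn_rpow hs).2 (Set.mem_Ici.2 hu0) (Set.mem_Ici.2 hv0)
      (by norm_num : (0 : ℝ) ≤ 1 / 2) (by norm_num : (0 : ℝ) ≤ 1 / 2) (by norm_num)
    simp only [smul_eq_mul] at h2
    rw [hu, hv, pow_eq, pow_eq, ← hu, ← hv] at h2
    rw [show (u + v) / 2 = 1 / 2 * u + 1 / 2 * v by ring]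
    refine h2.trans ?_
    rw [Finset.mul_sum, Finset.mul_sum, ← Finset.sum_add_distrib]
    refine Finset.sum_le_sum fun i _ => ?_
    have := abs_add_rpow_add_abs_sub_rpow_le hq (x i) (y i)
    rw [mul_pow, Real.sq_sqrt hκ]
    simp only [Pi.add_apply, Pi.sub_apply]
    linarith
  have h3 : (u + v) / 2 ≤ lpNormVec q x ^ 2 + lpNormVec q (√(6 * (q - 1)) • y) ^ 2 := by
    rw [lpNormVec_sq hq0, lpNormVec_sq hq0]
    have h4 := Real.Lp_add_le_of_nonneg Finset.univ (f := fun i => x i ^ 2)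
      (g := fun i => (√(6 * (q - 1)) * y i) ^ 2) hs (fun i _ => by positivity)
      (fun i _ => by positivity)
    refine le_trans ?_ h4
    rw [← Real.rpow_le_rpow_iff (by positivity) (by positivity) hs0, ← Real.rpow_mul (by positivity),
      one_div_mul_cancel hs0.ne', Real.rpow_one]
    exact h1
  rw [lpNormVec_smul hq0, mul_pow, sq_abs, Real.sq_sqrt hκ] at h3
  linarith

/-- Equality case of Hölder: `g` is half the gradient of `‖·‖_q ^ 2` at `θ`, namely `‖θ‖^(2-q)
sign(θ_i) |θ_i|^(q-1)`. -/
theorem exists_norming_vector {p q : ℝ} (hpq : p.HolderConjugate q) (θ : Fin D → ℝ) :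
    ∃ g : Fin D → ℝ, ∑ i, g i * θ i = lpNormVec q θ ^ 2 ∧ lpNormVec p g = lpNormVec q θ := by
  have hp0 := hpq.pos
  have hq0 := hpq.symm.pos
  rcases (lpNormVec_nonneg q θ).eq_or_lt with h | h
  · exact ⟨0, by simp [← h], by rw [lpNormVec_zero hp0, h]⟩
  · set r := lpNormVec q θ with hr
    have hrq : ∑ i, |θ i| ^ q = r ^ q := (lpNormVec_rpow hq0.ne' θ).symm
    have hqq : p * (q - 1) = q := by
      have := hpq.inv_add_inv_eq_one
      field_simp at this
      linarith
    refine ⟨r ^ (2 - q) • fun i => SignType.sign (θ i) * |θ i| ^ (q - 1), ?_, ?_⟩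
    · have : ∀ i, (r ^ (2 - q) • fun i => (SignType.sign (θ i) : ℝ) * |θ i| ^ (q - 1)) i * θ i
          = r ^ (2 - q) * |θ i| ^ q := by
        intro i
        simp only [Pi.smul_apply, smul_eq_mul]
        have e : |θ i| ^ q = |θ i| ^ (q - 1) * |θ i| := by
          rcases eq_or_ne (θ i) 0 with h0 | h0
          · simp [h0, hq0.ne']
          · rw [← Real.rpow_add_one (abs_ne_zero.2 h0)]; ring_nf
        rw [e]
        have := sign_mul_self (θ i)
        linear_combination r ^ (2 - q) * |θ i| ^ (q - 1) * this
      rw [Finset.sum_congr rfl fun i _ => this i, ← Finset.mul_sum, hrq, ← Real.rpow_add h,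
        ← Real.rpow_two]
      ring_nf
    · rw [lpNormVec_smul hp0, abs_of_pos (by positivity)]
      have : lpNormVec p (fun i => (SignType.sign (θ i) : ℝ) * |θ i| ^ (q - 1)) = r ^ (q - 1) := by
        unfold lpNormVec
        have : ∀ i, |(SignType.sign (θ i) : ℝ) * |θ i| ^ (q - 1)| ^ p = |θ i| ^ q := by
          intro i
          rcases eq_or_ne (θ i) 0 with h0 | h0
          · simp [h0, hq0.ne', hp0.ne']
          · have hs : |(SignType.sign (θ i) : ℝ)| = 1 := by
              rcases h0.lt_or_gt with h1 | h1 <;> simp [h1]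
            rw [abs_mul, hs, one_mul, abs_of_nonneg (by positivity),
              ← Real.rpow_mul (abs_nonneg _), mul_comm, hqq]
        rw [Finset.sum_congr rfl fun i _ => this i, hrq, ← Real.rpow_mul h.le]
        congr 1
        field_simp
        linarith
      rw [this, ← Real.rpow_add h]
      ring_nf
      exact Real.rpow_one _

/-- Testing `θ - y` against the norming vector of `θ` gives `‖θ - y‖² ≥ ‖θ‖² - 2⟨G θ, y⟩`;
substituting this into the approximate parallelogram law leaves an upper bound for `‖θ + y‖²`. -/
theorem exists_smooth_descent {p q : ℝ} (hpq : p.HolderConjugate q) (hq : 2 ≤ q) :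
    ∃ G : (Fin D → ℝ) → (Fin D → ℝ), ∀ θ y : Fin D → ℝ,
      lpNormVec q (θ + y) ^ 2
        ≤ lpNormVec q θ ^ 2 + 2 * ∑ i, G θ i * y i + 12 * (q - 1) * lpNormVec q y ^ 2 := by
  choose G hG1 hG2 using exists_norming_vector (D := D) hpq
  refine ⟨G, fun θ y => ?_⟩
  have h1 := lpNormVec_add_sq_add_sub_sq_le hq θ y
  have h2 := sum_mul_le_lpNormVec hpq (G θ) (θ - y)
  rw [hG2] at h2
  have h3 : ∑ i, G θ i * (θ - y) i = lpNormVec q θ ^ 2 - ∑ i, G θ i * y i := by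
    rw [← hG1, ← Finset.sum_sub_distrib]
    simp [mul_sub]
  nlinarith [sq_nonneg (lpNormVec q θ - lpNormVec q (θ - y))]

end LpNorm

/-! ### Sup-norm covers of the weight ball by greedy dual descent. -/

section Cover

variable {D : ℕ}

/-- A centre is the dual vector `G θ` of a sum `θ` of `T` moves, each `0` or `±η x_i`. For finite
`I` there are thus at most `(2|I| + 1) ^ T` centres, whatever `D` is. -/
theorem exists_sup_norm_cover {p q : ℝ} (hpq : p.HolderConjugate q) (hq : 2 ≤ q) {I : Type*}
    (x : I → Fin D → ℝ) {a b ε : ℝ} (hb : 0 < b) (hε : 0 < ε)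
    (hx : ∀ i, lpNormVec q (x i) ≤ b) (T : ℕ) (hT : 12 * (q - 1) * (a * b) ^ 2 ≤ T * ε ^ 2) :
    ∃ c : (Fin T → Option (I × Bool)) → Fin D → ℝ, ∀ w, lpNormVec p w ≤ a →
      ∃ s, ∀ i, |∑ j, (w j - c s j) * x i j| ≤ ε := by
  obtain ⟨G, hG⟩ := exists_smooth_descent (D := D) hpq hq
  have hq0 : 0 < q := by linarith
  have hq1 : 0 < q - 1 := by linarith
  -- This step size minimises `-2ηε + 12 (q - 1) b² η²`, the bound on the change of potential in one
  -- move.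
  set η := ε / (12 * (q - 1) * b ^ 2) with hη
  have hη0 : 0 < η := by positivity
  have hηδ : 12 * (q - 1) * b ^ 2 * η = ε := by rw [hη]; field_simp
  let step : Option (I × Bool) → Fin D → ℝ := fun o =>
    o.elim 0 fun z => (if z.2 then η else -η) • x z.1
  refine ⟨fun s => G (∑ t, step (s t)), fun w hw => ?_⟩
  let P : (Fin D → ℝ) → ℝ := fun θ => lpNormVec q θ ^ 2 - 2 * ∑ j, w j * θ j
  have hPlow : ∀ θ, -a ^ 2 ≤ P θ := by
    intro θ
    have h1 := sum_mul_le_lpNormVec hpq w θ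
    have h2 := lpNormVec_nonneg q θ
    have h3 := lpNormVec_nonneg p w
    have h4 : lpNormVec p w * lpNormVec q θ ≤ a * lpNormVec q θ := by gcongr
    simp only [P]
    nlinarith [sq_nonneg (lpNormVec q θ - a)]
  let good : (Fin D → ℝ) → Prop := fun θ => ∀ i, |∑ j, (w j - G θ j) * x i j| ≤ ε
  have hstep : ∀ θ, ¬ good θ → ∃ o, P (step o + θ) < P θ - ε * η := by
    intro θ hθ
    simp only [good, not_forall, not_le] at hθ
    obtain ⟨i, hi⟩ := hθ
    have key : ∀ s : ℝ, |s| = η → η * ε < s * ∑ j, (w j - G θ j) * x i j →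
        P (s • x i + θ) < P θ - ε * η := by
      intro s hs hlt
      have h1 := hG θ (s • x i)
      rw [lpNormVec_smul hq0, hs] at h1
      have h2 : lpNormVec q (x i) ^ 2 ≤ b ^ 2 := by
        have := lpNormVec_nonneg q (x i)
        gcongr
        exact hx i
      have h3 : ∑ j, w j * (s • x i + θ) j - ∑ j, G θ j * (s • x i) j
          = ∑ j, w j * θ j + s * ∑ j, (w j - G θ j) * x i j := by
        rw [Finset.mul_sum, ← Finset.sum_sub_distrib, ← Finset.sum_add_distrib]
        refine Finset.sum_congr rfl fun j _ => ?_
        simp only [Pi.add_apply, Pi.smul_apply, smul_eq_mul]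
        ring
      have h4 : 12 * (q - 1) * (η * lpNormVec q (x i)) ^ 2 ≤ ε * η := by
        calc 12 * (q - 1) * (η * lpNormVec q (x i)) ^ 2
            = 12 * (q - 1) * η ^ 2 * lpNormVec q (x i) ^ 2 := by ring
          _ ≤ 12 * (q - 1) * η ^ 2 * b ^ 2 := by gcongr
          _ = (12 * (q - 1) * b ^ 2 * η) * η := by ring
          _ = ε * η := by rw [hηδ]
      rw [add_comm θ] at h1
      simp only [P]
      linarith
    rcases lt_abs.1 hi with h | h
    · exact ⟨some (i, true), by
        simpa [step] using key η (abs_of_pos hη0) (by gcongr)⟩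
    · refine ⟨some (i, false), ?_⟩
      have := key (-η) (by rw [abs_neg, abs_of_pos hη0]) (by nlinarith)
      simpa [step] using this
  have hind : ∀ t : ℕ, ∃ s : Fin t → Option (I × Bool),
      good (∑ j, step (s j)) ∨ P (∑ j, step (s j)) ≤ -(t * (ε * η)) := by
    intro t
    induction t with
    | zero => exact ⟨Fin.elim0, Or.inr (by simp [P, lpNormVec_zero hq0])⟩
    | succ t ih =>
      obtain ⟨s, hs⟩ := ih
      by_cases hg : good (∑ j, step (s j))
      -- A descent that stops early is padded with zero moves, so that all codes have the same
      -- length.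
      · refine ⟨Fin.cons none s, Or.inl ?_⟩
        rw [Fin.sum_univ_succ]
        simpa [step] using hg
      · obtain ⟨o, ho⟩ := hstep _ hg
        have hP := hs.resolve_left hg
        refine ⟨Fin.cons o s, Or.inr ?_⟩
        rw [Fin.sum_univ_succ]
        simp only [Fin.cons_zero, Fin.cons_succ]
        push_cast
        linarith
  obtain ⟨s, hs⟩ := hind T
  refine ⟨s, ?_⟩
  by_contra hg
  -- If `T` moves did not suffice, one more would push the potential strictly below its lower bound
  -- `-a²`.
  have hP := hs.resolve_left hg
  obtain ⟨o, ho⟩ := hstep _ hg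
  have h1 := hPlow (step o + ∑ j, step (s j))
  have h2 : a ^ 2 ≤ T * (ε * η) := by
    have h3 : 12 * (q - 1) * b ^ 2 * a ^ 2 ≤ 12 * (q - 1) * b ^ 2 * (T * (ε * η)) := by
      calc _ = 12 * (q - 1) * (a * b) ^ 2 := by ring
        _ ≤ T * ε ^ 2 := hT
        _ = T * ε * (12 * (q - 1) * b ^ 2 * η) := by rw [hηδ]; ring
        _ = _ := by ring
    exact le_of_mul_le_mul_left h3 (by positivity)
  have : 0 < ε * η := by positivity
  linarith

end Cover

/-! ### Massart's lemma and finite chaining. -/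

section Rademacher

variable {m : ℕ}

theorem card_sign_vectors : (Fintype.card (Fin m → ℤˣ) : ℝ) = 2 ^ m := by
  simp [Fintype.card_pi]

theorem sum_sign_vectors_eq_zero (u : Fin m → ℝ) :
    ∑ σ : Fin m → ℤˣ, ∑ i, (((σ i : ℤˣ) : ℤ) : ℝ) * u i = 0 := by
  have h : ∑ σ : Fin m → ℤˣ, ∑ i, (((σ i : ℤˣ) : ℤ) : ℝ) * u i
      = ∑ σ : Fin m → ℤˣ, ∑ i, ((((-σ) i : ℤˣ) : ℤ) : ℝ) * u i :=
    (Equiv.sum_comp (Equiv.neg (Fin m → ℤˣ)) _).symm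
  simp only [Pi.neg_apply, Units.val_neg, Int.cast_neg, neg_mul, Finset.sum_neg_distrib] at h
  linarith

/-- The sum factorises over coordinates, and each factor is `2 cosh(t u_i) ≤ 2 exp((tB)²/2)`. -/
theorem sum_exp_sign_vectors_le (u : Fin m → ℝ) {B : ℝ} (hu : ∀ i, |u i| ≤ B) (t : ℝ) :
    ∑ σ : Fin m → ℤˣ, Real.exp (t * ∑ i, (((σ i : ℤˣ) : ℤ) : ℝ) * u i)
      ≤ 2 ^ m * Real.exp (m * (t * B) ^ 2 / 2) := by
  have h1 : ∀ σ : Fin m → ℤˣ, Real.exp (t * ∑ i, (((σ i : ℤˣ) : ℤ) : ℝ) * u i)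
      = ∏ i, Real.exp (t * ((((σ i : ℤˣ) : ℤ) : ℝ) * u i)) := by
    intro σ
    rw [Finset.mul_sum, Real.exp_sum]
  rw [Finset.sum_congr rfl fun σ _ => h1 σ]
  have h2 := Finset.prod_univ_sum (fun _ : Fin m => (Finset.univ : Finset ℤˣ))
    (fun i s => Real.exp (t * (((s : ℤ) : ℝ) * u i)))
  rw [Fintype.piFinset_univ] at h2
  rw [← h2]
  have h3 : ∀ i, ∑ s : ℤˣ, Real.exp (t * (((s : ℤ) : ℝ) * u i))
      ≤ 2 * Real.exp ((t * B) ^ 2 / 2) := by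
    intro i
    have e : ∑ s : ℤˣ, Real.exp (t * (((s : ℤ) : ℝ) * u i)) = 2 * Real.cosh (t * u i) := by
      rw [show (Finset.univ : Finset ℤˣ) = {1, -1} from rfl, Finset.sum_pair (by decide),
        Real.cosh_eq]
      simp
      ring
    rw [e]
    have h4 := Real.cosh_le_exp_half_sq (t * u i)
    have h5 : (t * u i) ^ 2 ≤ (t * B) ^ 2 := by
      rw [mul_pow, mul_pow]
      have : u i ^ 2 ≤ B ^ 2 := sq_le_sq' (by linarith [(abs_le.1 (hu i)).1]) (abs_le.1 (hu i)).2
      gcongr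
    have h6 : Real.exp ((t * u i) ^ 2 / 2) ≤ Real.exp ((t * B) ^ 2 / 2) := by gcongr
    linarith
  calc ∏ i, ∑ s : ℤˣ, Real.exp (t * (((s : ℤ) : ℝ) * u i))
      ≤ ∏ _i : Fin m, 2 * Real.exp ((t * B) ^ 2 / 2) :=
        Finset.prod_le_prod (fun i _ => by positivity) fun i _ => h3 i
    _ = 2 ^ m * Real.exp (m * (t * B) ^ 2 / 2) := by
        rw [Finset.prod_const, Finset.card_univ, Fintype.card_fin, mul_pow, ← Real.exp_nat_mul]
        ring_nf

/-- Massart's finite class lemma. -/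
theorem average_iSup_sign_vectors_le (hm : 0 < m) {U : Type*} [Finite U] [Nonempty U]
    (u : U → Fin m → ℝ) {B ℓ : ℝ} (hB : 0 < B) (hℓ : 0 < ℓ) (hu : ∀ j i, |u j i| ≤ B)
    (hcard : (Nat.card U : ℝ) ≤ Real.exp ℓ) :
    (1 / 2 ^ m) * ∑ σ : Fin m → ℤˣ, ⨆ j, ∑ i, (((σ i : ℤˣ) : ℤ) : ℝ) * u j i
      ≤ B * √(2 * m * ℓ) := by
  have := Fintype.ofFinite U
  rw [Nat.card_eq_fintype_card] at hcard
  have hm' : (0 : ℝ) < m := by exact_mod_cast hm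
  set M : (Fin m → ℤˣ) → ℝ := fun σ => ⨆ j, ∑ i, (((σ i : ℤˣ) : ℤ) : ℝ) * u j i with hM
  set R := √(2 * m * ℓ) with hR
  have hR0 : 0 < R := by positivity
  have hR2 : R ^ 2 = 2 * m * ℓ := Real.sq_sqrt (by positivity)
  -- The optimal exponent: it balances `m (tB)² / 2` against `ℓ`, making both equal.
  set t := R / (m * B) with ht
  have ht0 : 0 < t := by positivity
  have htB : t * B = R / m := by rw [ht]; field_simp
  have hexp : ∑ σ, Real.exp (t * M σ) ≤ 2 ^ m * Real.exp (2 * ℓ) := by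
    calc ∑ σ, Real.exp (t * M σ)
        ≤ ∑ σ : Fin m → ℤˣ, ∑ j, Real.exp (t * ∑ i, (((σ i : ℤˣ) : ℤ) : ℝ) * u j i) := by
          refine Finset.sum_le_sum fun σ _ => ?_
          obtain ⟨j, hj⟩ := exists_eq_ciSup_of_finite
            (f := fun j => ∑ i, (((σ i : ℤˣ) : ℤ) : ℝ) * u j i)
          simp only [hM]
          rw [← hj]
          exact Finset.single_le_sum
            (f := fun j => Real.exp (t * ∑ i, (((σ i : ℤˣ) : ℤ) : ℝ) * u j i))
            (fun j _ => (Real.exp_pos _).le) (Finset.mem_univ j)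
      _ = ∑ j, ∑ σ : Fin m → ℤˣ, Real.exp (t * ∑ i, (((σ i : ℤˣ) : ℤ) : ℝ) * u j i) :=
          Finset.sum_comm
      _ ≤ ∑ _j : U, 2 ^ m * Real.exp (m * (t * B) ^ 2 / 2) :=
          Finset.sum_le_sum fun j _ => sum_exp_sign_vectors_le (u j) (hu j) t
      _ = Fintype.card U * (2 ^ m * Real.exp ℓ) := by
          rw [Finset.sum_const, Finset.card_univ, nsmul_eq_mul, htB, div_pow, hR2]
          congr 3
          field_simp
      _ ≤ Real.exp ℓ * (2 ^ m * Real.exp ℓ) := by gcongr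
      _ = 2 ^ m * Real.exp (2 * ℓ) := by rw [two_mul, Real.exp_add]; ring
  have hsum : ∑ σ, t * M σ ≤ 2 ^ m * (2 * ℓ) := by
    -- Jensen's inequality in the form of the tangent line to `exp` at `2ℓ`.
    calc ∑ σ, t * M σ ≤ ∑ σ, (Real.exp (t * M σ) * Real.exp (-(2 * ℓ)) + (2 * ℓ - 1)) := by
          refine Finset.sum_le_sum fun σ _ => ?_
          rw [← Real.exp_add]
          linarith [Real.add_one_le_exp (t * M σ + -(2 * ℓ))]
      _ = (∑ σ, Real.exp (t * M σ)) * Real.exp (-(2 * ℓ)) + 2 ^ m * (2 * ℓ - 1) := by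
          rw [Finset.sum_add_distrib, ← Finset.sum_mul, Finset.sum_const, Finset.card_univ,
            nsmul_eq_mul, card_sign_vectors]
      _ ≤ 2 ^ m * Real.exp (2 * ℓ) * Real.exp (-(2 * ℓ)) + 2 ^ m * (2 * ℓ - 1) := by gcongr
      _ = 2 ^ m * (2 * ℓ) := by
          rw [mul_assoc, ← Real.exp_add, add_neg_cancel, Real.exp_zero]; ring
  rw [← Finset.mul_sum] at hsum
  have h2m : (0 : ℝ) < 2 ^ m := by positivity
  have hfin : t * ((1 / 2 ^ m) * ∑ σ, M σ) ≤ t * (B * R) := by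
    calc t * ((1 / 2 ^ m) * ∑ σ, M σ) = (1 / 2 ^ m) * (t * ∑ σ, M σ) := by ring
      _ ≤ (1 / 2 ^ m) * (2 ^ m * (2 * ℓ)) := by gcongr
      _ = 2 * ℓ := by field_simp
      _ = t * (B * R) := by
          rw [show t * (B * R) = t * B * R by ring, htB, div_mul_eq_mul_div, ← sq, hR2]
          field_simp
  exact le_of_mul_le_mul_left hfin ht0

/-- Dudley's chaining bound for finitely many levels of approximation. -/
theorem average_sSup_le_of_chain (hm : 0 < m) {W : Type*} [Nonempty W] (g : W → Fin m → ℝ)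
    (V : ℕ → W → Fin m → ℝ) (v₀ : Fin m → ℝ) (hV0 : ∀ w, V 0 w = v₀) (B ℓ : ℕ → ℝ) (K : ℕ)
    (hB : ∀ k < K, 0 < B k) (hℓ : ∀ k < K, 0 < ℓ k) (hdiff : ∀ k < K, ∀ w i,
      |V (k + 1) w i - V k w i| ≤ B k)
    (hfin : ∀ k < K, (Set.range fun w => V (k + 1) w - V k w).Finite)
    (hcard : ∀ k < K, ((Set.range fun w => V (k + 1) w - V k w).ncard : ℝ) ≤ Real.exp (ℓ k))
    {ε : ℝ} (hε : ∀ w i, |g w i - V K w i| ≤ ε) :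
    (1 / 2 ^ m) * ∑ σ : Fin m → ℤˣ, ⨆ w, (1 / (m : ℝ)) * ∑ i, (((σ i : ℤˣ) : ℤ) : ℝ) * g w i
      ≤ (∑ k ∈ Finset.range K, B k * √(2 * m * ℓ k)) / m + ε := by
  have hm' : (0 : ℝ) < m := by exact_mod_cast hm
  -- Telescoping along the levels. A majorant `H` is carried in place of the supremum, so suprema
  -- are taken only over finite sets of increments. The level-zero vector is constant in `w` and
  -- averages to zero over the signs.
  have hchain : ∀ k ≤ K, ∃ H : (Fin m → ℤˣ) → ℝ,
      (∀ σ w, ∑ i, (((σ i : ℤˣ) : ℤ) : ℝ) * V k w i ≤ H σ) ∧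
      (1 / 2 ^ m) * ∑ σ, H σ ≤ ∑ j ∈ Finset.range k, B j * √(2 * m * ℓ j) := by
    intro k
    induction k with
    | zero =>
      intro _
      refine ⟨fun σ => ∑ i, (((σ i : ℤˣ) : ℤ) : ℝ) * v₀ i, fun σ w => by rw [hV0], ?_⟩
      rw [sum_sign_vectors_eq_zero]
      simp
    | succ k ih =>
      intro hk
      have hk' : k < K := hk
      obtain ⟨H, hH1, hH2⟩ := ih hk'.le
      let U := Set.range fun w => V (k + 1) w - V k w
      have : Finite U := hfin k hk'
      have : Nonempty U := (Set.range_nonempty _).to_subtype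
      have hmas := average_iSup_sign_vectors_le hm (fun u : U => u.1) (hB k hk') (hℓ k hk')
        (by rintro ⟨_, w, rfl⟩ i; exact hdiff k hk' w i) (hcard k hk')
      refine ⟨fun σ => H σ + ⨆ u : U, ∑ i, (((σ i : ℤˣ) : ℤ) : ℝ) * u.1 i, fun σ w => ?_, ?_⟩
      · have h1 : ∑ i, (((σ i : ℤˣ) : ℤ) : ℝ) * (V (k + 1) w - V k w) i
            ≤ ⨆ u : U, ∑ i, (((σ i : ℤˣ) : ℤ) : ℝ) * u.1 i :=
          le_ciSup (f := fun u : U => ∑ i, (((σ i : ℤˣ) : ℤ) : ℝ) * u.1 i)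
            (Set.finite_range _).bddAbove ⟨_, w, rfl⟩
        have h2 := hH1 σ w
        simp only [Pi.sub_apply, mul_sub, Finset.sum_sub_distrib] at h1
        linarith
      · rw [Finset.sum_range_succ, Finset.sum_add_distrib, mul_add]
        exact add_le_add hH2 hmas
  obtain ⟨H, hH1, hH2⟩ := hchain K le_rfl
  have hpt : ∀ σ : Fin m → ℤˣ,
      ⨆ w, (1 / (m : ℝ)) * ∑ i, (((σ i : ℤˣ) : ℤ) : ℝ) * g w i ≤ (1 / m) * H σ + ε := by
    intro σ
    refine ciSup_le fun w => ?_
    have h1 : ∑ i, (((σ i : ℤˣ) : ℤ) : ℝ) * g w i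
        ≤ ∑ i, ((((σ i : ℤˣ) : ℤ) : ℝ) * V K w i + ε) := by
      refine Finset.sum_le_sum fun i _ => ?_
      have h2 := abs_le.1 (hε w i)
      rcases Int.units_eq_one_or (σ i) with h | h <;> rw [h] <;> simp <;> linarith
    rw [Finset.sum_add_distrib, Finset.sum_const, Finset.card_univ, Fintype.card_fin,
      nsmul_eq_mul] at h1
    calc (1 / (m : ℝ)) * ∑ i, (((σ i : ℤˣ) : ℤ) : ℝ) * g w i
        ≤ (1 / m) * (H σ + m * ε) := by
          gcongr
          linarith [hH1 σ w]
      _ = (1 / m) * H σ + ε := by field_simp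
  calc _ ≤ (1 / 2 ^ m) * ∑ σ : Fin m → ℤˣ, ((1 / m) * H σ + ε) := by
        gcongr with σ
        exact hpt σ
    _ = ((1 / 2 ^ m) * ∑ σ, H σ) / m + ε := by
        rw [Finset.sum_add_distrib, Finset.sum_const, Finset.card_univ, nsmul_eq_mul,
          card_sign_vectors, ← Finset.mul_sum]
        field_simp
    _ ≤ _ := by gcongr

end Rademacher

/-! ### Lipschitz dependence of the margin loss on the scores. -/

section MarginLoss

theorem clip_nonneg {M : ℝ} (hM : 0 ≤ M) (r : ℝ) : 0 ≤ clip M r :=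
  le_min hM (le_max_left _ _)

theorem clip_le (M r : ℝ) : clip M r ≤ M :=
  min_le_left _ _

theorem abs_clip_sub_clip_le (M r s : ℝ) : |clip M r - clip M s| ≤ |r - s| := by
  unfold clip
  refine (abs_min_sub_min_le_max _ _ _ _).trans (max_le (by simp) ?_)
  refine (abs_max_sub_max_le_max _ _ _ _).trans (max_le (by simp) le_rfl)

theorem abs_ciSup_sub_ciSup_le {ι : Type*} [Finite ι] {f g : ι → ℝ} {c : ℝ} (hc : 0 ≤ c)
    (h : ∀ i, |f i - g i| ≤ c) : |(⨆ i, f i) - ⨆ i, g i| ≤ c := by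
  rcases isEmpty_or_nonempty ι with hι | hι
  · simpa using hc
  · have key : ∀ f g : ι → ℝ, (∀ i, |f i - g i| ≤ c) → (⨆ i, f i) ≤ (⨆ i, g i) + c := by
      intro f g h
      refine ciSup_le fun i => ?_
      have h1 := le_ciSup (Set.finite_range g).bddAbove i
      linarith [(abs_le.1 (h i)).2]
    have h1 := key f g h
    have h2 := key g f fun i => by rw [abs_sub_comm]; exact h i
    exact abs_le.2 ⟨by linarith, by linarith⟩

variable {X 𝒴 : Type*}

theorem maxLoss_nonneg {L : 𝒴 → 𝒴 → ℝ} (hL : ∀ y y', 0 ≤ L y y') : 0 ≤ maxLoss L :=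
  Real.iSup_nonneg fun _ => hL _ _

theorem marginLoss_nonneg {L : 𝒴 → 𝒴 → ℝ} (hL : ∀ y y', 0 ≤ L y y') (ρ : ℝ) (h : X → 𝒴 → ℝ)
    (x : X) (y : 𝒴) : 0 ≤ marginLoss L ρ h x y :=
  clip_nonneg (maxLoss_nonneg hL) _

theorem marginLoss_le (L : 𝒴 → 𝒴 → ℝ) (ρ : ℝ) (h : X → 𝒴 → ℝ) (x : X) (y : 𝒴) :
    marginLoss L ρ h x y ≤ maxLoss L :=
  clip_le _ _

variable [Finite 𝒴]

/-- Clipping and suprema are 1-Lipschitz, and each margin involves two scores, whence the factor `2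
/ ρ`. -/
theorem abs_marginLoss_sub_le (L : 𝒴 → 𝒴 → ℝ) {ρ : ℝ} (hρ : 0 < ρ) {h h' : X → 𝒴 → ℝ} {x : X}
    {c : ℝ} (hc : ∀ y, |h x y - h' x y| ≤ c) (y : 𝒴) :
    |marginLoss L ρ h x y - marginLoss L ρ h' x y| ≤ 2 / ρ * c := by
  have hc0 : 0 ≤ c := (abs_nonneg _).trans (hc y)
  refine (abs_clip_sub_clip_le _ _ _).trans (abs_ciSup_sub_ciSup_le (by positivity) ?_)
  rintro ⟨y', _⟩
  have e : L y' y - 1 / ρ * (h x y - h x y') - (L y' y - 1 / ρ * (h' x y - h' x y'))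
      = 1 / ρ * ((h x y' - h' x y') - (h x y - h' x y)) := by ring
  rw [e, abs_mul, abs_of_pos (by positivity), show 2 / ρ * c = 1 / ρ * (c + c) by ring]
  gcongr
  exact (abs_sub _ _).trans (add_le_add (hc y') (hc y))

theorem continuous_marginLoss (L : 𝒴 → 𝒴 → ℝ) {ρ : ℝ} (hρ : 0 < ρ) (x : X) (y : 𝒴) :
    Continuous fun r : 𝒴 → ℝ => marginLoss L ρ (fun _ : X => r) x y := by
  have := Fintype.ofFinite 𝒴
  refine (LipschitzWith.of_dist_le_mul (K := ⟨2 / ρ, by positivity⟩) fun r r' => ?_).continuous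
  rw [Real.dist_eq]
  exact abs_marginLoss_sub_le L hρ (fun y => by rw [← Real.dist_eq]; exact dist_le_pi_dist r r' y) y

end MarginLoss

/-! ### Linear scores and measurability of the complexity. -/

section Score

variable {X F : Type*} [Fintype F] {l D : ℕ} {N : F → Finset (Fin l)} {Y : Fin l → Type*}
  (Ψ : (f : F) → X → FactorLabel N Y f → (Fin D → ℝ))

theorem score_eq_sum (w : Fin D → ℝ) (x : X) (y : (k : Fin l) → Y k) :
    score N Ψ w x y = ∑ f, ∑ j, w j * Ψ f x (restrictLabel N y f) j := by
  simp only [score, jointFeature, Finset.sum_apply, Finset.mul_sum]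
  exact Finset.sum_comm

theorem abs_score_sub_le {w w' : Fin D → ℝ} {x : X} {c : ℝ}
    (hc : ∀ f yf, |∑ j, (w j - w' j) * Ψ f x yf j| ≤ c) (y : (k : Fin l) → Y k) :
    |score N Ψ w x y - score N Ψ w' x y| ≤ Fintype.card F * c := by
  rw [score_eq_sum, score_eq_sum, ← Finset.sum_sub_distrib]
  refine (Finset.abs_sum_le_sum_abs _ _).trans ?_
  have : ∀ f ∈ Finset.univ, |(∑ j, w j * Ψ f x (restrictLabel N y f) j)
      - ∑ j, w' j * Ψ f x (restrictLabel N y f) j| ≤ c := by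
    intro f _
    rw [← Finset.sum_sub_distrib]
    simpa only [sub_mul] using hc f (restrictLabel N y f)
  simpa using Finset.sum_le_card_nsmul _ _ _ this

theorem continuous_score (x : X) :
    Continuous fun w : Fin D → ℝ => score N Ψ w x := by
  unfold score
  fun_prop

theorem measurable_score [MeasurableSpace X] (hΨ : ∀ f y, Measurable fun x => Ψ f x y)
    (w : Fin D → ℝ) : Measurable fun x => score N Ψ w x := by
  refine measurable_pi_lambda _ fun y => ?_
  simp only [score_eq_sum]
  refine Finset.measurable_sum _ fun f _ => Finset.measurable_sum _ fun j _ => ?_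
  exact measurable_const.mul ((measurable_pi_apply j).comp (hΨ f _))

theorem empiricalRademacher_lossClass
    (L : ((k : Fin l) → Y k) → ((k : Fin l) → Y k) → ℝ) (p Λ ρ : ℝ) {m : ℕ}
    (S : Fin m → X × ((k : Fin l) → Y k)) :
    empiricalRademacher (lossClass N Ψ L p Λ ρ) S
      = (1 / 2 ^ m) * ∑ σ : Fin m → ℤˣ, ⨆ w : {w : Fin D → ℝ // lpNormVec p w ≤ Λ},
        (1 / (m : ℝ)) * ∑ i, (((σ i : ℤˣ) : ℤ) : ℝ)
          * marginLoss L ρ (score N Ψ w) (S i).1 (S i).2 := by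
  unfold empiricalRademacher
  congr 1
  refine Finset.sum_congr rfl fun σ _ => ?_
  have : lossClass N Ψ L p Λ ρ = Set.range fun w : {w : Fin D → ℝ // lpNormVec p w ≤ Λ} =>
      fun z : X × ((k : Fin l) → Y k) => marginLoss L ρ (score N Ψ w) z.1 z.2 := by
    ext g
    simp only [lossClass, linearClass, Set.mem_image, Set.mem_ofPred_eq, Set.mem_range,
      Subtype.exists]
    constructor
    · rintro ⟨_, ⟨w, hw, rfl⟩, rfl⟩
      exact ⟨w, hw, rfl⟩
    · rintro ⟨w, hw, rfl⟩
      exact ⟨_, ⟨w, hw, rfl⟩, rfl⟩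
  rw [this, ← Set.range_comp]
  rfl

theorem abs_signed_average_le {L : ((k : Fin l) → Y k) → ((k : Fin l) → Y k) → ℝ}
    (hL : ∀ y y', 0 ≤ L y y') (ρ : ℝ) {m : ℕ}
    (S : Fin m → X × ((k : Fin l) → Y k)) (σ : Fin m → ℤˣ) (w : Fin D → ℝ) :
    |(1 / (m : ℝ)) * ∑ i, (((σ i : ℤˣ) : ℤ) : ℝ)
        * marginLoss L ρ (score N Ψ w) (S i).1 (S i).2| ≤ maxLoss L := by
  rw [abs_mul, abs_of_nonneg (by positivity)]
  have h1 : |∑ i, (((σ i : ℤˣ) : ℤ) : ℝ) * marginLoss L ρ (score N Ψ w) (S i).1 (S i).2|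
      ≤ m * maxLoss L := by
    refine (Finset.abs_sum_le_sum_abs _ _).trans ?_
    have : ∀ i ∈ Finset.univ, |(((σ i : ℤˣ) : ℤ) : ℝ)
        * marginLoss L ρ (score N Ψ w) (S i).1 (S i).2| ≤ maxLoss L := by
      intro i _
      have h2 : |(((σ i : ℤˣ) : ℤ) : ℝ)| = 1 := by
        rcases Int.units_eq_one_or (σ i) with h | h <;> rw [h] <;> simp
      rw [abs_mul, h2, one_mul, abs_of_nonneg (marginLoss_nonneg hL _ _ _ _)]
      exact marginLoss_le L _ _ _ _
    simpa using Finset.sum_le_card_nsmul _ _ _ this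
  rcases Nat.eq_zero_or_pos m with rfl | hm
  · simpa using maxLoss_nonneg hL
  · have hm' : (0 : ℝ) < m := by exact_mod_cast hm
    calc _ ≤ 1 / (m : ℝ) * (m * maxLoss L) := by gcongr
      _ = maxLoss L := by field_simp

variable [∀ k, Finite (Y k)] (L : ((k : Fin l) → Y k) → ((k : Fin l) → Y k) → ℝ)

theorem continuous_marginLoss_score {ρ : ℝ} (hρ : 0 < ρ) (x : X) (y : (k : Fin l) → Y k) :
    Continuous fun w : Fin D → ℝ => marginLoss L ρ (score N Ψ w) x y :=
  (continuous_marginLoss L hρ x y).comp (continuous_score Ψ x)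

theorem measurable_marginLoss_score [MeasurableSpace X] [∀ k, MeasurableSpace (Y k)]
    [∀ k, MeasurableSingletonClass (Y k)] (hΨ : ∀ f y, Measurable fun x => Ψ f x y)
    {ρ : ℝ} (hρ : 0 < ρ) (w : Fin D → ℝ) :
    Measurable fun z : X × ((k : Fin l) → Y k) => marginLoss L ρ (score N Ψ w) z.1 z.2 := by
  refine measurable_from_prod_countable_left fun y => ?_
  rcases isEmpty_or_nonempty X with hX | ⟨⟨x₀⟩⟩
  · exact measurable_of_empty _
  -- The loss at `(x, y)` sees the score only through the vector of its values at `x`, so the base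
  -- point `x₀` is immaterial.
  · exact (continuous_marginLoss L hρ x₀ y).measurable.comp (measurable_score Ψ hΨ w)

theorem abs_marginLoss_score_sub_le {ρ : ℝ} (hρ : 0 < ρ) {w w' : Fin D → ℝ} {x : X} {c : ℝ}
    (hc : ∀ f yf, |∑ j, (w j - w' j) * Ψ f x yf j| ≤ c) (y : (k : Fin l) → Y k) :
    |marginLoss L ρ (score N Ψ w) x y - marginLoss L ρ (score N Ψ w') x y|
      ≤ 2 * Fintype.card F / ρ * c := by
  refine (abs_marginLoss_sub_le L hρ (abs_score_sub_le Ψ hc) y).trans (le_of_eq ?_)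
  ring

variable {L}

/-- The loss is continuous in `w`, so the supremum over the ball equals one over a countable dense
sequence and is measurable; it is bounded by `maxLoss L`. -/
theorem integrable_empiricalRademacher [MeasurableSpace X] [∀ k, MeasurableSpace (Y k)]
    [∀ k, MeasurableSingletonClass (Y k)] (hΨ : ∀ f y, Measurable fun x => Ψ f x y)
    (hL : ∀ y y', 0 ≤ L y y') {p Λ ρ : ℝ} (hp : 0 < p) (hΛ : 0 ≤ Λ) (hρ : 0 < ρ) (m : ℕ)
    (μ : Measure (Fin m → X × ((k : Fin l) → Y k))) [IsFiniteMeasure μ] :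
    Integrable (fun S => empiricalRademacher (lossClass N Ψ L p Λ ρ) S) μ := by
  simp only [empiricalRademacher_lossClass]
  refine Integrable.const_mul (integrable_finsetSum _ fun σ _ => ?_) _
  let W := {w : Fin D → ℝ // lpNormVec p w ≤ Λ}
  have : Nonempty W := ⟨⟨0, by rw [lpNormVec_zero hp]; exact hΛ⟩⟩
  let φ : (Fin m → X × ((k : Fin l) → Y k)) → W → ℝ := fun S w => (1 / (m : ℝ)) *
    ∑ i, (((σ i : ℤˣ) : ℤ) : ℝ) * marginLoss L ρ (score N Ψ w) (S i).1 (S i).2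
  have hφb : ∀ S w, |φ S w| ≤ maxLoss L := fun S w => abs_signed_average_le Ψ hL ρ S σ w
  have hbdd : ∀ S, BddAbove (Set.range (φ S)) := fun S =>
    ⟨maxLoss L, by rintro _ ⟨w, rfl⟩; exact (abs_le.1 (hφb S w)).2⟩
  have hcont : ∀ S, Continuous (φ S) := fun S =>
    continuous_const.mul (continuous_finsetSum _ fun i _ => continuous_const.mul
      ((continuous_marginLoss_score Ψ L hρ _ _).comp continuous_subtype_val))
  have heq : ∀ S, ⨆ w, φ S w = ⨆ n, φ S (TopologicalSpace.denseSeq W n) := by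
    intro S
    have hb : BddAbove (Set.range fun n => φ S (TopologicalSpace.denseSeq W n)) :=
      (hbdd S).mono (Set.range_comp_subset_range _ (φ S))
    refine le_antisymm (ciSup_le fun w => ?_) (ciSup_le fun n => le_ciSup (hbdd S) _)
    have hc : IsClosed {w | φ S w ≤ ⨆ n, φ S (TopologicalSpace.denseSeq W n)} :=
      isClosed_le (hcont S) continuous_const
    have hsub : Set.range (TopologicalSpace.denseSeq W)
        ⊆ {w | φ S w ≤ ⨆ n, φ S (TopologicalSpace.denseSeq W n)} := by
      rintro _ ⟨n, rfl⟩
      exact le_ciSup hb n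
    exact closure_minimal hsub hc (TopologicalSpace.denseRange_denseSeq W w)
  have hmeas : Measurable fun S => ⨆ w, φ S w := by
    simp only [heq]
    refine Measurable.iSup fun n => ?_
    refine measurable_const.mul (Finset.measurable_sum _ fun i _ => measurable_const.mul ?_)
    exact (measurable_marginLoss_score Ψ L hΨ hρ _).comp (measurable_pi_apply i)
  refine Integrable.of_bound hmeas.aestronglyMeasurable (maxLoss L) (Filter.Eventually.of_forall ?_)
  intro S
  rw [Real.norm_eq_abs]
  obtain ⟨w₀⟩ := id this
  exact abs_le.2 ⟨(abs_le.1 (hφb S w₀)).1.trans (le_ciSup (hbdd S) w₀),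
    ciSup_le fun w => (abs_le.1 (hφb S w)).2⟩

end Score

/-! ### Numerical constants of the chaining sum. -/

theorem two_le_conjExponent_of_le_two {p q : ℝ} (hp1 : 1 < p) (hp2 : p ≤ 2) (hq : q = p / (p - 1)) : 2 ≤ q := by
  rw [hq, le_div_iff₀ (by linarith)]
  linarith

theorem chain_sum_le {A q ℓ : ℝ} (hA : 0 ≤ A) (hq : 1 ≤ q - 1) (hℓ : 1 ≤ ℓ) {m : ℕ} (hm : 2 ≤ m) :
    ((Nat.log 2 m + 1 : ℕ) : ℝ) * (3 * A * √(52 * m * (q - 1) * ℓ)) / m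
        + A * (1 / 2) ^ (Nat.log 2 m + 1)
      ≤ 72 * √(q - 1) * A / √(m : ℝ) * (√ℓ * Real.log m) := by
  have hm2 : (2 : ℝ) ≤ m := by exact_mod_cast hm
  have hm0 : (0 : ℝ) < m := by linarith
  have hlog2 := Real.log_two_gt_d9
  have hlogm : Real.log 2 ≤ Real.log m := Real.log_le_log (by norm_num) hm2
  set K := Nat.log 2 m + 1 with hK
  have hKle : (K : ℝ) * Real.log 2 ≤ 2 * Real.log m := by
    have h1 : (2 : ℝ) ^ Nat.log 2 m ≤ m := by exact_mod_cast Nat.pow_log_le_self 2 (by omega)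
    have h2 := Real.log_le_log (by positivity) h1
    rw [Real.log_pow] at h2
    rw [hK]
    push_cast
    linarith
  have hpow : (1 / 2 : ℝ) ^ K ≤ 1 / m := by
    have h1 : (m : ℝ) ≤ 2 ^ K := by
      exact_mod_cast (Nat.lt_pow_succ_log_self (by norm_num) m).le
    rw [one_div_pow]
    exact one_div_le_one_div_of_le hm0 h1
  have hs52 : √(52 : ℝ) ≤ 7.22 := by
    rw [Real.sqrt_le_left (by norm_num)]
    norm_num
  have hsm : (0 : ℝ) < √(m : ℝ) := Real.sqrt_pos.2 hm0
  have hsm1 : (1 : ℝ) ≤ √(m : ℝ) := Real.one_le_sqrt.2 (by linarith)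
  have hsmsq : √(m : ℝ) * √(m : ℝ) = m := Real.mul_self_sqrt hm0.le
  have hq1 : 1 ≤ √(q - 1) := Real.one_le_sqrt.2 hq
  have hℓ1 : 1 ≤ √ℓ := Real.one_le_sqrt.2 hℓ
  have hqℓ : 1 ≤ √(q - 1) * √ℓ := by nlinarith
  have hsplit : √(52 * m * (q - 1) * ℓ) = √52 * √(m : ℝ) * (√(q - 1) * √ℓ) := by
    rw [Real.sqrt_mul (by positivity), Real.sqrt_mul (by positivity), Real.sqrt_mul (by norm_num)]
    ring
  rw [hsplit]
  set Q := √(q - 1) * √ℓ with hQ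
  have e1 : (K : ℝ) * (3 * A * (√52 * √(m : ℝ) * Q)) / m = A / √(m : ℝ) * (3 * K * √52 * Q) := by
    have := Real.sqrt_div_self' (x := (m : ℝ))
    linear_combination K * 3 * A * √52 * Q * this
  have e2 : A * (1 / 2) ^ K ≤ A / √(m : ℝ) * 1 := by
    rw [mul_one]
    calc A * (1 / 2) ^ K ≤ A * (1 / m) := by gcongr
      _ = A / m := by ring
      _ ≤ A / √(m : ℝ) := by
        gcongr
        nlinarith
  have e3 : 72 * √(q - 1) * A / √(m : ℝ) * (√ℓ * Real.log m)
      = A / √(m : ℝ) * (72 * Real.log m * Q) := by rw [hQ]; ring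
  rw [e1, e3]
  -- Since `K log 2 ≤ 2 log m`, the left side is at most about `(62.5 log m + 1) Q`; the slack up to
  -- `72 log m` absorbs the `1` coming from the last approximation error.
  have hnum : 3 * K * √52 * Q + 1 ≤ 72 * Real.log m * Q := by
    have h1 : (3 : ℝ) * K * √52 ≤ 3 * K * 7.22 := by gcongr
    have h2 : (3 : ℝ) * K * √52 + 1 ≤ 72 * Real.log m := by nlinarith
    have h3 : 0 ≤ 3 * K * √52 := by positivity
    nlinarith
  calc _ ≤ A / √(m : ℝ) * (3 * K * √52 * Q) + A / √(m : ℝ) * 1 := by linarith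
    _ = A / √(m : ℝ) * (3 * K * √52 * Q + 1) := by ring
    _ ≤ _ := by gcongr

/-! ### Chaining for the loss class. -/

section Bound

variable {X F : Type*} [Fintype F] {l D : ℕ} {N : F → Finset (Fin l)} {Y : Fin l → Type*}
  [∀ k, Finite (Y k)] (Ψ : (f : F) → X → FactorLabel N Y f → (Fin D → ℝ))
  (L : ((k : Fin l) → Y k) → ((k : Fin l) → Y k) → ℝ)

/-- The bound on the empirical complexity by Dudley chaining along sup-norm covers of the linear
class on the points `Ψ_f(x_i, y_f)`. -/
theorem empiricalRademacher_lossClass_le_of_pos {p q a b ρ : ℝ} (hpq : p.HolderConjugate q)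
    (hq : 2 ≤ q) (hρ : 0 < ρ) (ha : 0 < a) (hb : 0 < b) (hF : 0 < Fintype.card F)
    (hΨ : ∀ f x y, lpNormVec q (Ψ f x y) ≤ b) {m : ℕ} (hm : 2 ≤ m)
    (S : Fin m → X × ((k : Fin l) → Y k)) {ℓ : ℝ} (hℓ1 : 1 ≤ ℓ)
    (hℓ : Real.log (2 * Nat.card (Fin m × Σ f, FactorLabel N Y f) + 1) ≤ ℓ) :
    empiricalRademacher (lossClass N Ψ L p a ρ) S
      ≤ 72 * √(q - 1) * (2 * Fintype.card F / ρ * (a * b)) / √(m : ℝ) * (√ℓ * Real.log m) := by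
  set I := Fin m × Σ f, FactorLabel N Y f
  set A := 2 * Fintype.card F / ρ * (a * b) with hA
  have hF' : (0 : ℝ) < Fintype.card F := by exact_mod_cast hF
  have hA0 : 0 < A := by positivity
  have hq1 : 1 ≤ q - 1 := by linarith
  let W := {w : Fin D → ℝ // lpNormVec p w ≤ a}
  have hW : Nonempty W := ⟨⟨0, by rw [lpNormVec_zero hpq.pos]; exact ha.le⟩⟩
  -- The number of moves needed at scale `ab / 2^k`; rounding up costs at most `(q - 1) 4^k`, hence
  -- the constant 13 below.
  let T : ℕ → ℕ := fun k => ⌈12 * (q - 1) * 4 ^ k⌉₊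
  have hTle : ∀ k, (T k : ℝ) ≤ 13 * (q - 1) * 4 ^ k := by
    intro k
    have h1 := Nat.ceil_lt_add_one (a := 12 * (q - 1) * 4 ^ k) (by positivity)
    have h2 : (1 : ℝ) ≤ (q - 1) * 4 ^ k := one_le_mul_of_one_le_of_one_le hq1
      (one_le_pow₀ (by norm_num))
    simp only [T]
    linarith
  have hcover : ∀ k, ∃ c : (Fin (T k) → Option (I × Bool)) → Fin D → ℝ, ∀ w : W,
      ∃ s, ∀ i : I, |∑ j, (w.1 j - c s j) * Ψ i.2.1 (S i.1).1 i.2.2 j| ≤ a * b * (1 / 2) ^ k := by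
    intro k
    obtain ⟨c, hc⟩ := exists_sup_norm_cover hpq hq
      (fun i : I => Ψ i.2.1 (S i.1).1 i.2.2) (a := a) (ε := a * b * (1 / 2) ^ k) hb (by positivity)
      (fun i => hΨ _ _ _) (T k) (by
        have h1 : 12 * (q - 1) * 4 ^ k ≤ (T k : ℝ) := Nat.le_ceil _
        calc 12 * (q - 1) * (a * b) ^ 2
            = 12 * (q - 1) * 4 ^ k * (a * b * (1 / 2) ^ k) ^ 2 := by
              have h2 : (4 : ℝ) ^ k * ((1 / 2) ^ k) ^ 2 = 1 := by
                rw [← pow_mul, mul_comm k 2, pow_mul, ← mul_pow]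
                norm_num
              linear_combination -12 * (q - 1) * (a * b) ^ 2 * h2
          _ ≤ _ := by gcongr)
    exact ⟨c, fun w => hc w.1 w.2⟩
  choose c s hs using hcover
  let val : (Fin D → ℝ) → Fin m → ℝ := fun w i =>
    marginLoss L ρ (score N Ψ w) (S i).1 (S i).2
  -- Chaining must start from a single vector, so level zero uses the weight `0`, which by Hölder
  -- already has accuracy `ab`.
  let φ : ∀ k, (Fin (T k) → Option (I × Bool)) → Fin m → ℝ := fun k r =>
    if k = 0 then val 0 else val (c k r)
  let V : ℕ → W → Fin m → ℝ := fun k w => φ k (s k w)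
  have happrox : ∀ k (w : W) i, |val w.1 i - V k w i| ≤ A * (1 / 2) ^ k := by
    intro k w i
    by_cases hk : k = 0
    · simp only [V, φ, hk, pow_zero, mul_one]
      refine abs_marginLoss_score_sub_le Ψ L hρ (fun f yf => ?_) _
      simp only [Pi.zero_apply, sub_zero]
      refine (abs_sum_mul_le_lpNormVec hpq _ _).trans ?_
      exact mul_le_mul w.2 (hΨ _ _ _) (lpNormVec_nonneg _ _) ha.le
    · simp only [V, φ, if_neg hk]
      rw [hA, mul_assoc]
      exact abs_marginLoss_score_sub_le Ψ L hρ (fun f yf => hs k w (i, ⟨f, yf⟩)) _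
  have hsub : ∀ k, (Set.range fun w => V (k + 1) w - V k w) ⊆
      Set.range fun z : (Fin (T (k + 1)) → Option (I × Bool)) × (Fin (T k) → Option (I × Bool)) =>
        φ (k + 1) z.1 - φ k z.2 := by
    rintro k _ ⟨w, rfl⟩
    exact ⟨(s (k + 1) w, s k w), rfl⟩
  -- Increments have size at most `A 2^-k + A 2^-(k+1) = 3A 2^-(k+1)` and are determined by a pair
  -- of codes, of total length at most `26 (q - 1) 4^(k+1)`.
  have hmain := average_sSup_le_of_chain (m := m) (by omega) (fun w : W => val w.1) V (val 0)
    (fun w => rfl) (fun k => 3 * A * (1 / 2) ^ (k + 1))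
    (fun k => 26 * (q - 1) * 4 ^ (k + 1) * ℓ) (Nat.log 2 m + 1)
    (fun k _ => by positivity) (fun k _ => by positivity)
    (fun k _ w i => by
      have h1 := abs_le.1 (happrox k w i)
      have h2 := abs_le.1 (happrox (k + 1) w i)
      have h3 : A * (1 / 2) ^ k = 2 * (A * (1 / 2) ^ (k + 1)) := by rw [pow_succ]; ring
      exact abs_le.2 ⟨by linarith, by linarith⟩)
    (fun k _ => (Set.finite_range _).subset (hsub k))
    (fun k _ => by
      have h1 := (Set.ncard_le_ncard (hsub k) (Set.finite_range _)).trans (Finite.card_range_le _)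
      rw [Nat.card_prod, Nat.card_fun, Nat.card_fun, ← pow_add, Nat.card_fin, Nat.card_fin,
        Finite.card_option, Nat.card_prod, Nat.card_eq_fintype_card (α := Bool),
        Fintype.card_bool] at h1
      have h2 : (0 : ℝ) < 2 * Nat.card I + 1 := by positivity
      have h0 : 0 ≤ Real.log (2 * Nat.card I + 1) := Real.log_nonneg (by
        have : (0 : ℝ) ≤ Nat.card I := by positivity
        linarith)
      calc ((Set.range fun w => V (k + 1) w - V k w).ncard : ℝ)
          ≤ (2 * Nat.card I + 1 : ℝ) ^ (T (k + 1) + T k) := by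
            rw [mul_comm (2 : ℝ)]
            exact_mod_cast h1
        _ = Real.exp ((T (k + 1) + T k : ℕ) * Real.log (2 * Nat.card I + 1)) := by
            rw [Real.exp_nat_mul, Real.exp_log h2]
        _ ≤ _ := by
            rw [Real.exp_le_exp]
            push_cast
            have h3 := hTle k
            have h4 := hTle (k + 1)
            have h5 : 13 * (q - 1) * 4 ^ k ≤ 13 * (q - 1) * 4 ^ (k + 1) := by
              gcongr <;> norm_num
            have h6 : (T (k + 1) : ℝ) + T k ≤ 26 * (q - 1) * 4 ^ (k + 1) := by linarith
            gcongr)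
    (happrox _)
  rw [empiricalRademacher_lossClass]
  refine hmain.trans (le_trans (le_of_eq ?_) (chain_sum_le hA0.le hq1 hℓ1 hm))
  -- The decay `2^-(k+1)` cancels the square root of `4^(k+1)`, so all levels contribute the same
  -- amount.
  have hterm : ∀ k, 3 * A * (1 / 2) ^ (k + 1) * √(2 * m * (26 * (q - 1) * 4 ^ (k + 1) * ℓ))
      = 3 * A * √(52 * m * (q - 1) * ℓ) := by
    intro k
    have e : 2 * m * (26 * (q - 1) * 4 ^ (k + 1) * ℓ)
        = (2 ^ (k + 1)) ^ 2 * (52 * m * (q - 1) * ℓ) := by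
      rw [← pow_mul, mul_comm (k + 1) 2, pow_mul]
      norm_num
      ring
    have e2 : (1 / 2 : ℝ) ^ (k + 1) * 2 ^ (k + 1) = 1 := by rw [← mul_pow]; norm_num
    rw [e, Real.sqrt_mul (by positivity), Real.sqrt_sq (by positivity)]
    linear_combination 3 * A * √(52 * m * (q - 1) * ℓ) * e2
  rw [Finset.sum_congr rfl fun k _ => hterm k, Finset.sum_const, Finset.card_range, nsmul_eq_mul]

/-- With Lipschitz radius zero every weight in the ball has the same losses as `0`, so a chain of
zero levels with error zero suffices. -/
theorem empiricalRademacher_lossClass_nonpos {p q a b ρ : ℝ} (hpq : p.HolderConjugate q)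
    (hρ : 0 < ρ) (ha : 0 ≤ a) (hzero : 2 * Fintype.card F / ρ * (a * b) = 0)
    (hΨ : ∀ f x y, lpNormVec q (Ψ f x y) ≤ b) {m : ℕ} (hm : 0 < m)
    (S : Fin m → X × ((k : Fin l) → Y k)) :
    empiricalRademacher (lossClass N Ψ L p a ρ) S ≤ 0 := by
  let W := {w : Fin D → ℝ // lpNormVec p w ≤ a}
  have hW : Nonempty W := ⟨⟨0, by rw [lpNormVec_zero hpq.pos]; exact ha⟩⟩
  let val : (Fin D → ℝ) → Fin m → ℝ := fun w i =>
    marginLoss L ρ (score N Ψ w) (S i).1 (S i).2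
  have h := average_sSup_le_of_chain hm (fun w : W => val w.1) (fun _ _ => val 0) (val 0)
    (fun _ => rfl) 0 0 0 (by simp) (by simp) (by simp) (by simp) (by simp) (ε := 0)
    (fun w i => by
      rw [← hzero]
      refine abs_marginLoss_score_sub_le Ψ L hρ (fun f yf => ?_) _
      simp only [Pi.zero_apply, sub_zero]
      refine (abs_sum_mul_le_lpNormVec hpq _ _).trans ?_
      exact mul_le_mul w.2 (hΨ _ _ _) (lpNormVec_nonneg _ _) ha)
  rw [empiricalRademacher_lossClass]
  simpa using h

theorem empiricalRademacher_lossClass_le_complexityBound {d : ℕ}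
    (hd : ∀ f, Nat.card (FactorLabel N Y f) = d) {p q a b ρ : ℝ} (hpq : p.HolderConjugate q)
    (hq : 2 ≤ q) (hρ : 0 < ρ) (ha : 0 ≤ a) (hb : 0 ≤ b)
    (hΨ : ∀ f x y, lpNormVec q (Ψ f x y) ≤ b) {m : ℕ} (hm : 2 ≤ m)
    (S : Fin m → X × ((k : Fin l) → Y k)) :
    empiricalRademacher (lossClass N Ψ L p a ρ) S
      ≤ complexityBound m d (Fintype.card F) q b a ρ := by
  have hm2 : (2 : ℝ) ≤ m := by exact_mod_cast hm
  have hlogm : 0 ≤ Real.log m := Real.log_nonneg (by linarith)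
  unfold complexityBound logFactor
  -- The degenerate case is split off because the covers need a positive radius, and because `d ≥ 1`
  -- requires a factor to exist.
  by_cases hzero : 2 * Fintype.card F / ρ * (a * b) = 0
  · refine (empiricalRademacher_lossClass_nonpos Ψ L hpq hρ ha hzero hΨ (by omega) S).trans ?_
    positivity
  · have hF : 0 < Fintype.card F := Nat.pos_of_ne_zero fun h => hzero (by simp [h])
    have ha' : 0 < a := ha.lt_of_ne' fun h => hzero (by simp [h])
    have hb' : 0 < b := hb.lt_of_ne' fun h => hzero (by simp [h])
    obtain ⟨f₀⟩ := Fintype.card_pos_iff.1 hF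
    have hd1 : 1 ≤ d := by
      rw [← hd f₀]
      have : Nonempty (FactorLabel N Y f₀) := ⟨restrictLabel N (S ⟨0, by omega⟩).2 f₀⟩
      exact Nat.card_pos
    have hcard : Nat.card (Fin m × Σ f, FactorLabel N Y f) = m * (Fintype.card F * d) := by
      rw [Nat.card_prod, Nat.card_fin, Nat.card_sigma, Finset.sum_congr rfl fun f _ => hd f]
      simp
    have hn : (2 : ℝ) ≤ m * d * Fintype.card F := by
      have h1 : 1 ≤ d * Fintype.card F := Nat.mul_pos hd1 hF
      have h2 : 2 * 1 ≤ m * (d * Fintype.card F) := Nat.mul_le_mul hm h1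
      rw [mul_assoc]
      exact_mod_cast h2
    -- The bracket is at least `3`, so the stated logarithm dominates both `log(2 m d |F| + 1)` and
    -- `1`.
    have hlarge : 2 * (m * d * Fintype.card F : ℝ) ≤
        2 * m * d * Fintype.card F * (8 * b * a * m * Fintype.card F / ρ + 3) := by
      have h1 : 0 ≤ 8 * b * a * m * Fintype.card F / ρ := by positivity
      nlinarith
    have h1 := empiricalRademacher_lossClass_le_of_pos Ψ L hpq hq hρ ha' hb' hF hΨ hm S
      (ℓ := Real.log
        (2 * m * d * Fintype.card F * (8 * b * a * m * Fintype.card F / ρ + 3) + 1)) (by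
        rw [Real.le_log_iff_exp_le (by linarith)]
        linarith [Real.exp_one_lt_d9]) (by
        rw [hcard]
        push_cast
        refine Real.log_le_log (by positivity) ?_
        linarith)
    refine h1.trans ?_
    have h2 : (0 : ℝ) ≤ 4 / m := by positivity
    refine le_trans (le_of_eq ?_) (le_add_of_nonneg_left h2)
    rw [mul_comm ρ √(m : ℝ)]
    field_simp
    ring

end Bound

theorem mainTheorem1
    {X : Type*} [MeasurableSpace X]
    {l : ℕ} {Y : Fin l → Type*} [∀ k, Finite (Y k)]
    [∀ k, MeasurableSpace (Y k)] [∀ k, MeasurableSingletonClass (Y k)]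
    {F : Type*} [Fintype F] (N : F → Finset (Fin l))
    (d : ℕ) (hd : ∀ f, Nat.card (FactorLabel N Y f) = d)
    {D : ℕ} (Ψ : (f : F) → X → FactorLabel N Y f → (Fin D → ℝ))
    (hΨmeas : ∀ f y, Measurable fun x => Ψ f x y)
    (L : ((k : Fin l) → Y k) → ((k : Fin l) → Y k) → ℝ) (hL : ∀ y y', 0 ≤ L y y')
    (p q Λ ρ : ℝ) (hp1 : 1 < p) (hp2 : p ≤ 2) (hq : q = p / (p - 1))
    (hΛ : 0 ≤ Λ) (hρ : 0 < ρ) (hΨbdd : BddAbove (featureNorms N Ψ q))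
    (m : ℕ) (hm : 2 ≤ m) :
    (∀ S : Fin m → X × ((k : Fin l) → Y k),
      empiricalRademacher (lossClass N Ψ L p Λ ρ) S
        ≤ complexityBound m d (Fintype.card F) q (featureSup N Ψ q) Λ ρ) ∧
    (∀ μ : Measure (X × ((k : Fin l) → Y k)), IsProbabilityMeasure μ →
      Integrable (fun S : Fin m → X × ((k : Fin l) → Y k) =>
        empiricalRademacher (lossClass N Ψ L p Λ ρ) S) (Measure.pi fun _ => μ) ∧
      rademacherComplexity μ m (lossClass N Ψ L p Λ ρ)
        ≤ complexityBound m d (Fintype.card F) q (featureSup N Ψ q) Λ ρ) := by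
  have hq2 := two_le_conjExponent_of_le_two hp1 hp2 hq
  have hpq : p.HolderConjugate q := by
    rw [hq]
    exact Real.HolderConjugate.conjExponent hp1
  have hΨle : ∀ f x y, lpNormVec q (Ψ f x y) ≤ featureSup N Ψ q := fun f x y =>
    le_csSup hΨbdd ⟨f, x, y, rfl⟩
  have hs0 : 0 ≤ featureSup N Ψ q := Real.sSup_nonneg (by
    rintro _ ⟨f, x, y, rfl⟩
    exact lpNormVec_nonneg _ _)
  have hemp : ∀ S : Fin m → X × ((k : Fin l) → Y k),
      empiricalRademacher (lossClass N Ψ L p Λ ρ) S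
        ≤ complexityBound m d (Fintype.card F) q (featureSup N Ψ q) Λ ρ :=
    empiricalRademacher_lossClass_le_complexityBound Ψ L hd hpq hq2 hρ hΛ hs0 hΨle hm
  refine ⟨hemp, fun μ hμ => ?_⟩
  have hint := integrable_empiricalRademacher Ψ hΨmeas hL hpq.pos hΛ hρ m
    (Measure.pi fun _ : Fin m => μ)
  refine ⟨hint, ?_⟩
  calc rademacherComplexity μ m (lossClass N Ψ L p Λ ρ)
      ≤ ∫ _S : Fin m → X × ((k : Fin l) → Y k),
          complexityBound m d (Fintype.card F) q (featureSup N Ψ q) Λ ρ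
            ∂(Measure.pi fun _ => μ) := integral_mono hint (integrable_const _) hemp
    _ = complexityBound m d (Fintype.card F) q (featureSup N Ψ q) Λ ρ := by simp
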